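/- All graphs are finite, simple and undirected. A \emph{$2$-linear coloring} of a graph $G$ is a map $c\colon E(G)\to\{1,2\}$ such that each color class is a linear forest, i.e. a forest each of whose connected components is a path (equivalently, every vertex is incident with at most two edges of each color, and no cycle has all its edges of the same color). Given such a coloring, a vertex is \emph{monochromatic} if it has degree $2$ and both edges incident with it have the same color. A \emph{partial $2$-tree} is a graph that has a tree decomposition of width at most $2$. \textbf{Theorem.} Let $G$ be a partial $2$-tree of maximum degree at most $4$, and let $\mathcal{S}$ be a collection of pairwise disjoint two-element sets of vertices of degree $2$ in $G$. Then $G$ has a $2$-linear coloring such that at most one vertex of each member of $\mathcal{S}$ is monochromatic. -/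

import Mathlib

namespace SimpleGraph

universe u

/-- A tree decomposition of `G` over the tree `T`, with bags `bag t`: every vertex of `G` lies in
some bag, the two ends of every edge lie in a common bag, and for each vertex of `G` the nodes whose
bags contain it induce a connected subgraph of `T`. -/
structure IsTreeDecomposition {V : Type u} (G : SimpleGraph V) {ι : Type} (T : SimpleGraph ι)
    (bag : ι → Finset V) : Prop where
  isTree : T.IsTree
  exists_mem_bag : ∀ v : V, ∃ t : ι, v ∈ bag t
  exists_mem_bag_of_adj : ∀ v w : V, G.Adj v w → ∃ t : ι, v ∈ bag t ∧ w ∈ bag t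
  connected : ∀ v : V, (T.induce {t : ι | v ∈ bag t}).Connected

/-- A partial `k`-tree: a graph with a (finite) tree decomposition of width at most `k`, the width
being the largest size of a bag minus one. -/
def IsPartialKTree {V : Type u} (G : SimpleGraph V) (k : ℕ) : Prop :=
  ∃ (ι : Type) (_ : Finite ι) (T : SimpleGraph ι) (bag : ι → Finset V),
    G.IsTreeDecomposition T bag ∧ ∀ t : ι, (bag t).card ≤ k + 1

/-- A linear forest (on a finite vertex set): a forest in which every vertex has at most two
neighbours, i.e. a forest each of whose connected components is a path. -/
def IsLinearForest {V : Type u} (H : SimpleGraph V) : Prop :=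
  H.IsAcyclic ∧ ∀ v : V, (H.neighborSet v).encard ≤ 2

/-- A `k`-linear coloring: an edge coloring (not necessarily proper) with `k` colors in which each
color class is a linear forest. -/
def IsLinearColoring {V : Type u} {G : SimpleGraph V} {k : ℕ} (c : G.EdgeLabeling (Fin k)) : Prop :=
  ∀ i : Fin k, (c.labelGraph i).IsLinearForest

/-- A vertex is monochromatic if it has degree 2 and both edges at it have the same color. -/
def IsMonochromatic {V : Type u} {G : SimpleGraph V} {k : ℕ} (c : G.EdgeLabeling (Fin k))
    (v : V) : Prop :=
  (G.neighborSet v).encard = 2 ∧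
    ∀ (x y : V) (hx : G.Adj v x) (hy : G.Adj v y), c.get v x hx = c.get v y hy

/-- A disjoint collection of pairs of degree-2 vertices of `G`. -/
structure IsDisjointPairsOfDegreeTwo {V : Type u} (G : SimpleGraph V)
    (S : Finset (Finset V)) : Prop where
  card_eq_two : ∀ P ∈ S, P.card = 2
  degree_eq_two : ∀ P ∈ S, ∀ v ∈ P, (G.neighborSet v).encard = 2
  disjoint : ∀ P ∈ S, ∀ Q ∈ S, P ≠ Q → Disjoint P Q

/-- The coloring `c` satisfies `S`: at most one vertex in each member of `S` is monochromatic. -/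
def Satisfies {V : Type u} {G : SimpleGraph V} {k : ℕ} (c : G.EdgeLabeling (Fin k))
    (S : Finset (Finset V)) : Prop :=
  ∀ P ∈ S, {v : V | v ∈ P ∧ IsMonochromatic c v}.Subsingleton

end SimpleGraph

/-!
The theorem is proved by induction on the edge set, deleting one of five configurations from the
graph and extending a coloring of the rest. What makes the extensions possible is the freedom to
choose the pairs: a constraint "not both of `x` and `y` become monochromatic" on the coloring of the
smaller graph can be imposed by pairing `x` with `y` there. Two vertices are thus worth pairing if
they both have degree `2` after the deletion, or if they are the partners of vertices whose colors
will be in conflict. So the induction is over all pairings (`SimpleGraph.IsPairColorable`); the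
pairs are the edges of a matching `M`, and need not have degree `2` since only vertices of degree
`2` can be monochromatic.

Unavoidability (`SimpleGraph.HasWeakTreewidthLE.exists_configuration`): a graph of treewidth at
most `2` with an edge has a vertex of degree `1`; or a vertex of degree `2` with a neighbor of
degree at most `3`; or two vertices of degree `2` with the same neighbors; or a vertex of degree
`4` in two triangles which each contain a vertex of degree `2`. This follows from the existence of
a vertex of degree at most `2` in the minor obtained by suppressing all vertices of degree `2`.

Reducibility: an edge `xy` can be given a color if `x` has at most one edge and `y` has no edge of
that color, for then no cycle arises (`SimpleGraph.HasColorDegrees.sup_edge`). All extensions are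
sequences of such steps, so that only the numbers of edges of each color at each vertex matter. The
configurations are treated in `SimpleGraph.IsPairColorable.of_leaf`, `of_adj_degree_two`,
`of_adj_degree_three`, `of_twins` and `of_triangles`.
-/

namespace SimpleGraph

/-! ### Vertices of small degree in partial `k`-trees -/

/-- A tree decomposition in which vertices of `G` may be missing from all bags, so that it passes
to minors of `G` on the same vertex type. Connectedness of the set of nodes whose bags contain `v`
is expressed as convexity: that set contains the path of `T` between any two of its members. -/
structure IsWeakTreeDecomposition {V : Type*} (G : SimpleGraph V) {ι : Type} (T : SimpleGraph ι)
    (bag : ι → Finset V) : Prop where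
  isTree : T.IsTree
  exists_mem_bag_of_adj : ∀ v w : V, G.Adj v w → ∃ t : ι, v ∈ bag t ∧ w ∈ bag t
  convex : ∀ (v : V) (s t : ι) (p : T.Walk s t), p.IsPath → v ∈ bag s → v ∈ bag t →
    ∀ r ∈ p.support, v ∈ bag r

/-- `G` has a weak tree decomposition of width at most `k`. -/
def HasWeakTreewidthLE {V : Type*} (G : SimpleGraph V) (k : ℕ) : Prop :=
  ∃ (ι : Type) (_ : Finite ι) (T : SimpleGraph ι) (bag : ι → Finset V),
    G.IsWeakTreeDecomposition T bag ∧ ∀ t : ι, (bag t).card ≤ k + 1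

/-- In a tree, a set of nodes containing some walk from `s` to `t` contains the path
from `s` to `t`. -/
lemma IsTree.forall_mem_support_of_walk {ι : Type*} {T : SimpleGraph ι} (hT : T.IsTree)
    {C : ι → Prop} {s t : ι} (q : T.Walk s t) (hq : ∀ r ∈ q.support, C r)
    (p : T.Walk s t) (hp : p.IsPath) : ∀ r ∈ p.support, C r := by
  classical
  intro r hr
  have h : p = q.bypass := (hT.existsUnique_path s t).unique hp q.bypass_isPath
  exact hq r (q.support_bypass_subset_support (h ▸ hr))

lemma IsPartialKTree.hasWeakTreewidthLE {V : Type*} {G : SimpleGraph V} {k : ℕ}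
    (hG : G.IsPartialKTree k) : G.HasWeakTreewidthLE k := by
  obtain ⟨ι, hι, T, bag, h, hcard⟩ := hG
  refine ⟨ι, hι, T, bag, ⟨h.isTree, h.exists_mem_bag_of_adj, ?_⟩, hcard⟩
  intro v s t p hp hs ht
  obtain ⟨q⟩ := (h.connected v).preconnected ⟨s, hs⟩ ⟨t, ht⟩
  refine h.isTree.forall_mem_support_of_walk (q.map (Embedding.induce _).toHom) ?_ p hp
  intro r hr
  obtain ⟨x, -, rfl⟩ := List.mem_map.1 (Walk.support_map _ q ▸ hr)
  exact x.2

lemma HasWeakTreewidthLE.anti {V : Type*} {G H : SimpleGraph V} {k : ℕ}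
    (hG : G.HasWeakTreewidthLE k) (hle : H ≤ G) : H.HasWeakTreewidthLE k := by
  obtain ⟨ι, hι, T, bag, h, hcard⟩ := hG
  exact ⟨ι, hι, T, bag, ⟨h.isTree, fun v w hvw => h.exists_mem_bag_of_adj v w (hle hvw),
    h.convex⟩, hcard⟩

/-- Weak treewidth does not increase when each vertex is either kept or contracted into a kept
neighbor. -/
lemma HasWeakTreewidthLE.of_contract {V : Type*} {G H : SimpleGraph V} {k : ℕ}
    (hG : G.HasWeakTreewidthLE k) (φ : V → V) (hφ : ∀ y, φ y = y ∨ G.Adj y (φ y))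
    (hφφ : ∀ y, φ (φ y) = φ y)
    (hH : ∀ a b, H.Adj a b → ∃ y z, G.Adj y z ∧ φ y = a ∧ φ z = b) :
    H.HasWeakTreewidthLE k := by
  classical
  obtain ⟨ι, hι, T, bag, h, hcard⟩ := hG
  have key : ∀ s y, y ∈ bag s → ∃ r, y ∈ bag r ∧ φ y ∈ bag r := by
    intro s y hy
    rcases hφ y with e | e
    · exact ⟨s, hy, e.symm ▸ hy⟩
    · exact h.exists_mem_bag_of_adj _ _ e
  refine ⟨ι, hι, T, fun t => (bag t).image φ, ⟨h.isTree, ?_, ?_⟩,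
    fun t => Finset.card_image_le.trans (hcard t)⟩
  · intro a b hab
    obtain ⟨y, z, hyz, rfl, rfl⟩ := hH a b hab
    obtain ⟨t, hy, hz⟩ := h.exists_mem_bag_of_adj _ _ hyz
    exact ⟨t, Finset.mem_image_of_mem _ hy, Finset.mem_image_of_mem _ hz⟩
  · intro x s t p hp hs ht
    obtain ⟨y, hy, rfl⟩ := Finset.mem_image.1 hs
    obtain ⟨z, hz, hzy⟩ := Finset.mem_image.1 ht
    obtain ⟨r, hyr, hxr⟩ := key s y hy
    obtain ⟨r', hzr, hxr'⟩ := key t z hz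
    rw [hzy] at hxr'
    obtain ⟨p₁, hp₁, -⟩ := h.isTree.existsUnique_path s r
    obtain ⟨p₂, hp₂, -⟩ := h.isTree.existsUnique_path r r'
    obtain ⟨p₃, hp₃, -⟩ := h.isTree.existsUnique_path r' t
    refine h.isTree.forall_mem_support_of_walk ((p₁.append p₂).append p₃) ?_ p hp
    intro q hq
    rw [Walk.mem_support_append_iff, Walk.mem_support_append_iff] at hq
    rcases hq with (hq | hq) | hq
    · exact Finset.mem_image_of_mem _ (h.convex y s r p₁ hp₁ hy hyr q hq)
    · exact Finset.mem_image.2 ⟨φ y, h.convex _ r r' p₂ hp₂ hxr hxr' q hq, hφφ y⟩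
    · exact Finset.mem_image.2 ⟨z, h.convex z r' t p₃ hp₃ hzr hz q hq, hzy⟩

/-- If the edges at `a` are all covered by one bag, then `a` has few neighbors. -/
lemma ncard_neighborSet_le_of_bag {V : Type*} {G : SimpleGraph V} {k : ℕ} {a : V} {B : Finset V}
    (hB : B.card ≤ k + 1) (ha : a ∈ B) (hN : ∀ b, G.Adj a b → b ∈ B) :
    (G.neighborSet a).ncard ≤ k := by
  classical
  have hsub : G.neighborSet a ⊆ (B.erase a : Finset V) := by
    intro b hb
    exact Finset.mem_coe.2 (Finset.mem_erase.2 ⟨hb.ne', hN b hb⟩)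
  have h1 := Set.ncard_le_ncard hsub (Finset.finite_toSet _)
  rw [Set.ncard_coe_finset, Finset.card_erase_of_mem ha] at h1
  omega

/-- A graph of weak treewidth at most `k` with an edge has a non-isolated vertex of degree at
most `k`: a vertex that lies in the bag of a leaf of the tree but not in the bag of the node next
to it will do, and if there is none then the leaf can be removed. -/
lemma HasWeakTreewidthLE.exists_ncard_neighborSet_le {V : Type*} {G : SimpleGraph V}
    {k : ℕ} (hG : G.HasWeakTreewidthLE k) (hne : G ≠ ⊥) :
    ∃ a, (∃ b, G.Adj a b) ∧ (G.neighborSet a).ncard ≤ k := by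
  classical
  obtain ⟨ι, hι, T, bag, h, hcard⟩ := hG
  induction hn : Nat.card ι using Nat.strong_induction_on generalizing ι with
  | _ n ih =>
  obtain ⟨a, b, hab⟩ := ne_bot_iff_exists_adj.1 hne
  have := Fintype.ofFinite ι
  rcases subsingleton_or_nontrivial ι with hsub | hnt
  · obtain ⟨t, hat, -⟩ := h.exists_mem_bag_of_adj a b hab
    refine ⟨a, ⟨b, hab⟩, ncard_neighborSet_le_of_bag (hcard t) hat fun c hc => ?_⟩
    obtain ⟨r, -, hr⟩ := h.exists_mem_bag_of_adj a c hc
    exact Subsingleton.elim t r ▸ hr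
  obtain ⟨t, ht⟩ := h.isTree.exists_vert_degree_one_of_nontrivial
  obtain ⟨s, hts, hs⟩ := degree_eq_one_iff_existsUnique_adj.1 ht
  by_cases hx : ∃ x, (∃ y, G.Adj x y) ∧ x ∈ bag t ∧ x ∉ bag s
  · obtain ⟨x, hxy, hxt, hxs⟩ := hx
    refine ⟨x, hxy, ncard_neighborSet_le_of_bag (hcard t) hxt fun c hc => ?_⟩
    obtain ⟨r, hxr, hr⟩ := h.exists_mem_bag_of_adj x c hc
    obtain ⟨p, hp, -⟩ := h.isTree.existsUnique_path t r
    have hconv := h.convex x t r p hp hxt hxr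
    cases p with
    | nil => exact hr
    | cons e q =>
      obtain rfl := hs _ e
      exact absurd (hconv _ (by simp)) hxs
  · push Not at hx
    refine ih (Nat.card ({t}ᶜ : Set ι)) ?_ ({t}ᶜ : Set ι) inferInstance (T.induce {t}ᶜ)
      (fun r => bag r) ⟨⟨?_, h.isTree.isAcyclic.induce _⟩, ?_, ?_⟩ (fun r => hcard r) rfl
    · rw [← hn]
      exact Finite.card_subtype_lt (x := t) (by simp)
    · exact h.isTree.connected.induce_compl_singleton_of_degree_eq_one ht
    · intro v w hvw
      obtain ⟨r, hv, hw⟩ := h.exists_mem_bag_of_adj v w hvw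
      by_cases hr : r = t
      · subst hr
        exact ⟨⟨s, hts.ne'⟩, hx v ⟨w, hvw⟩ hv, hx w ⟨v, hvw.symm⟩ hw⟩
      · exact ⟨⟨r, hr⟩, hv, hw⟩
    · intro v r r' p hp hr hr' q hq
      refine h.convex v r r' (p.map (Embedding.induce _).toHom)
        (hp.map Subtype.val_injective) hr hr' q ?_
      have hq' := List.mem_map_of_mem (f := (Embedding.induce (G := T) {t}ᶜ).toHom) hq
      rwa [← Walk.support_map] at hq'

/-! ### Unavoidable configurations -/

/-- Every graph of weak treewidth at most `2` with an edge contains a vertex of degree `1`, or a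
vertex of degree `2` with a neighbor of degree at most `3`, or two vertices of degree `2` with the
same neighbors, or two triangles `w v₁ u₁` and `w v₂ u₂` sharing the vertex `w` of degree `4`, with
`v₁` and `v₂` of degree `2`. Otherwise suppress all vertices of degree `2` (they are pairwise
nonadjacent): the result `H` is a minor of `G`, so has a vertex `w` of degree at most `2`. Each
neighbor of `w` in `H` comes from at most one edge of `G` and at most one suppressed vertex, while
`w` has degree at least `4` in `G`; so it comes from exactly one of each, which is the last
configuration. -/
theorem HasWeakTreewidthLE.exists_configuration {V : Type*} [Finite V] {G : SimpleGraph V}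
    (hG : G.HasWeakTreewidthLE 2) (hne : G ≠ ⊥) :
    (∃ v w, G.neighborSet v = {w}) ∨
    (∃ v u w, u ≠ w ∧ G.neighborSet v = {u, w} ∧ (G.neighborSet u).ncard ≤ 3) ∨
    (∃ v₁ v₂ a b, v₁ ≠ v₂ ∧ a ≠ b ∧ 4 ≤ (G.neighborSet a).ncard ∧
      4 ≤ (G.neighborSet b).ncard ∧ G.neighborSet v₁ = {a, b} ∧ G.neighborSet v₂ = {a, b}) ∨
    (∃ w v₁ v₂ u₁ u₂, v₁ ≠ v₂ ∧ u₁ ≠ u₂ ∧ G.neighborSet w = {v₁, v₂, u₁, u₂} ∧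
      (G.neighborSet w).ncard = 4 ∧ 4 ≤ (G.neighborSet u₁).ncard ∧
      4 ≤ (G.neighborSet u₂).ncard ∧
      G.neighborSet v₁ = {w, u₁} ∧ G.neighborSet v₂ = {w, u₂}) := by
  classical
  by_contra! hcon
  obtain ⟨h1, h2, h3, h4⟩ := hcon
  have two : ∀ v a, (G.neighborSet v).ncard = 2 → G.Adj v a →
      ∃ b, a ≠ b ∧ G.neighborSet v = {a, b} := by
    intro v a hv hva
    obtain ⟨x, y, hxy, e⟩ := Set.ncard_eq_two.1 hv
    have : a ∈ ({x, y} : Set V) := e ▸ hva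
    rcases this with rfl | rfl
    · exact ⟨y, hxy, e⟩
    · exact ⟨x, hxy.symm, e.trans (Set.pair_comm _ _)⟩
  have four : ∀ v a, (G.neighborSet v).ncard = 2 → G.Adj v a → 4 ≤ (G.neighborSet a).ncard := by
    intro v a hv hva
    obtain ⟨b, hab, e⟩ := two v a hv hva
    have := h2 v a b hab e
    omega
  have ex : ∀ v, ∃ y, ((G.neighborSet v).ncard = 2 ∧ G.Adj v y) ∨
      ((G.neighborSet v).ncard ≠ 2 ∧ y = v) := by
    intro v
    by_cases hv : (G.neighborSet v).ncard = 2
    · obtain ⟨x, y, hxy, e⟩ := Set.ncard_eq_two.1 hv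
      have hx : x ∈ G.neighborSet v := e ▸ Set.mem_insert _ _
      exact ⟨x, .inl ⟨hv, hx⟩⟩
    · exact ⟨v, .inr ⟨hv, rfl⟩⟩
  choose φ hφ using ex
  let H : SimpleGraph V :=
    { Adj := fun a b => a ≠ b ∧ (G.neighborSet a).ncard ≠ 2 ∧ (G.neighborSet b).ncard ≠ 2 ∧
        (G.Adj a b ∨ ∃ v, (G.neighborSet v).ncard = 2 ∧ G.Adj v a ∧ G.Adj v b)
      symm := ⟨fun a b ⟨hab, ha, hb, h⟩ => ⟨hab.symm, hb, ha, h.imp Adj.symm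
        fun ⟨v, hv, hva, hvb⟩ => ⟨v, hv, hvb, hva⟩⟩⟩
      loopless := ⟨fun a h => h.1 rfl⟩ }
  have hH2 : H.HasWeakTreewidthLE 2 := by
    refine hG.of_contract φ (fun y => ?_) (fun y => ?_) ?_
    · rcases hφ y with ⟨-, h⟩ | ⟨-, h⟩
      · exact .inr h
      · exact .inl h
    · rcases hφ y with ⟨hy, h⟩ | ⟨-, h⟩
      · have := four _ _ hy h
        rcases hφ (φ y) with ⟨h', -⟩ | ⟨-, h'⟩
        · omega
        · exact h'
      · rw [h, h]
    · rintro a b ⟨hab, ha, hb, h⟩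
      have fix : ∀ x, (G.neighborSet x).ncard ≠ 2 → φ x = x := fun x hx =>
        (hφ x).elim (fun h => absurd h.1 hx) And.right
      rcases h with h | ⟨v, hv, hva, hvb⟩
      · exact ⟨a, b, h, fix a ha, fix b hb⟩
      · obtain ⟨c, hac, e⟩ := two v a hv hva
        have hbc : b ∈ ({a, c} : Set V) := e ▸ hvb
        obtain rfl : b = c := hbc.resolve_left hab.symm
        have hvφ : G.Adj v (φ v) := (hφ v).elim And.right fun h => absurd hv h.1
        have : φ v ∈ ({a, b} : Set V) := e ▸ hvφ
        rcases this with h | h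
        · exact ⟨v, b, hvb, h, fix b hb⟩
        · exact ⟨a, v, hva.symm, fix a ha, h⟩
  have hHne : H ≠ ⊥ := by
    have via : ∀ x a, (G.neighborSet x).ncard = 2 → G.Adj x a → H ≠ ⊥ := by
      intro x a hx hxa
      obtain ⟨b, hab, e⟩ := two x a hx hxa
      have hxb : G.Adj x b := show b ∈ G.neighborSet x from e ▸ (by simp)
      have ha := four _ _ hx hxa
      have hb := four _ _ hx hxb
      exact ne_bot_iff_exists_adj.2 ⟨a, b, hab, by omega, by omega, .inr ⟨x, hx, hxa, hxb⟩⟩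
    obtain ⟨x, y, hxy⟩ := ne_bot_iff_exists_adj.1 hne
    by_cases hx : (G.neighborSet x).ncard = 2
    · exact via x y hx hxy
    by_cases hy : (G.neighborSet y).ncard = 2
    · exact via y x hy hxy.symm
    exact ne_bot_iff_exists_adj.2 ⟨x, y, hxy.ne, hx, hy, .inl hxy⟩
  obtain ⟨w, ⟨b, hwb⟩, hw⟩ := hH2.exists_ncard_neighborSet_le hHne
  have hw2 := hwb.2.1
  set A : Set V := {x | G.Adj w x ∧ (G.neighborSet x).ncard = 2} with hA
  set B : Set V := {x | G.Adj w x ∧ (G.neighborSet x).ncard ≠ 2} with hB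
  have hAB : G.neighborSet w = A ∪ B := by
    ext x
    simp only [hA, hB, mem_neighborSet, Set.mem_union, Set.mem_ofPred_eq]
    tauto
  have hdisj : Disjoint A B := Set.disjoint_left.2 fun x hx hx' => hx'.2 hx.2
  have hcard : (G.neighborSet w).ncard = A.ncard + B.ncard := by
    rw [hAB, Set.ncard_union_eq hdisj]
  have hBH : B ⊆ H.neighborSet w := fun x hx => ⟨hx.1.ne, hw2, hx.2, .inl hx.1⟩
  have hBle := Set.ncard_le_ncard hBH
  have ex : ∀ x, ∃ u, x ∈ A → w ≠ u ∧ G.neighborSet x = {w, u} := by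
    intro x
    by_cases hx : x ∈ A
    · obtain ⟨u, hu⟩ := two x w hx.2 hx.1.symm
      exact ⟨u, fun _ => hu⟩
    · exact ⟨x, fun h => absurd h hx⟩
  choose ψ hψ using ex
  have hxψ : ∀ x ∈ A, G.Adj x (ψ x) := fun x hx =>
    show ψ x ∈ G.neighborSet x from (hψ x hx).2 ▸ (by simp)
  have hinj : Set.InjOn ψ A := by
    intro x hx y hy hxy
    by_contra hne
    exact h3 x y w (ψ x) hne (hψ x hx).1 (four x w hx.2 hx.1.symm)
      (four _ _ hx.2 (hxψ x hx)) (hψ x hx).2 (hxy ▸ (hψ y hy).2)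
  have hAH : ψ '' A ⊆ H.neighborSet w := by
    rintro - ⟨x, hx, rfl⟩
    have := four _ _ hx.2 (hxψ x hx)
    exact ⟨(hψ x hx).1, hw2, by omega, .inr ⟨x, hx.2, hx.1.symm, hxψ x hx⟩⟩
  have hAle := Set.ncard_le_ncard hAH
  rw [hinj.ncard_image] at hAle
  have hA0 : A.Nonempty := by
    by_contra hA0
    rw [Set.not_nonempty_iff_eq_empty.1 hA0, Set.ncard_empty] at hcard
    have hne0 : (G.neighborSet w).ncard ≠ 0 := by
      intro h0
      have hemp := (Set.ncard_eq_zero).1 h0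
      rcases hwb.2.2.2 with h | ⟨v, -, h, -⟩
      · exact (hemp ▸ (show b ∈ G.neighborSet w from h) : b ∈ (∅ : Set V))
      · exact (hemp ▸ (show v ∈ G.neighborSet w from h.symm) : v ∈ (∅ : Set V))
    have hne1 : (G.neighborSet w).ncard ≠ 1 := by
      intro h0
      obtain ⟨u, hu⟩ := Set.ncard_eq_one.1 h0
      exact h1 w u hu
    omega
  obtain ⟨x, hx⟩ := hA0
  have hw4 := four x w hx.2 hx.1.symm
  obtain ⟨v₁, v₂, hv, hA2⟩ := Set.ncard_eq_two.1 (show A.ncard = 2 by omega)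
  have hBeq := Set.eq_of_subset_of_ncard_le hBH (by omega)
  have hψeq := Set.eq_of_subset_of_ncard_le hAH
    (by rw [hinj.ncard_image]; omega)
  have hBψ : B = {ψ v₁, ψ v₂} := by
    rw [hBeq, ← hψeq, hA2, Set.image_pair]
  have hm₁ : v₁ ∈ A := hA2 ▸ (by simp)
  have hm₂ : v₂ ∈ A := hA2 ▸ (by simp)
  refine h4 w v₁ v₂ (ψ v₁) (ψ v₂) hv (fun h => hv (hinj hm₁ hm₂ h)) ?_ (by omega)
    (four _ _ hm₁.2 (hxψ _ hm₁)) (four _ _ hm₂.2 (hxψ _ hm₂)) (hψ v₁ hm₁).2 (hψ v₂ hm₂).2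
  rw [hAB, hBψ, hA2]
  ext y
  simp
  tauto

/-! ### Decompositions into two linear forests and their color degrees -/

/-- `G` is the edge-disjoint union of two linear forests, indexed by `Bool`, in which the vertex
`v` has degrees `d true v` and `d false v`. Only these degrees matter when the decomposition is
extended to a larger graph. -/
def HasColorDegrees {V : Type*} (G : SimpleGraph V) (d : Bool → V → ℕ) : Prop :=
  ∃ F : Bool → SimpleGraph V, (∀ i, (F i).IsLinearForest) ∧ Disjoint (F true) (F false) ∧
    F true ⊔ F false = G ∧ ∀ i v, ((F i).neighborSet v).ncard = d i v

/-- The color degrees after an edge `xy` of color `i` has been added. -/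
def addColor {V : Type*} [DecidableEq V] (d : Bool → V → ℕ) (i : Bool) (x y : V) : Bool → V → ℕ :=
  fun j z => d j z + if j = i ∧ (z = x ∨ z = y) then 1 else 0

/-- The color degrees are those of a vertex of degree `2` with both edges of the same color. -/
def IsMono {V : Type*} (d : Bool → V → ℕ) (x : V) : Prop :=
  ∃ i, d i x = 2 ∧ d (!i) x = 0

lemma ncard_neighborSet_sup_edge {V : Type*} [Finite V] [DecidableEq V] {G : SimpleGraph V}
    {x y : V} (hxy : x ≠ y) (h : ¬ G.Adj x y) (z : V) :
    ((G ⊔ edge x y).neighborSet z).ncard =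
      (G.neighborSet z).ncard + if z = x ∨ z = y then 1 else 0 := by
  have aux : ∀ u v : V, u ≠ v → ¬ G.Adj u v →
      ((G ⊔ edge u v).neighborSet u).ncard = (G.neighborSet u).ncard + 1 := by
    intro u v huv h
    have : (G ⊔ edge u v).neighborSet u = insert v (G.neighborSet u) := by
      ext w
      simp only [mem_neighborSet, sup_adj, edge_adj, Set.mem_insert_iff]
      grind
    rw [this, Set.ncard_insert_of_notMem (by simpa using h)]
  by_cases hx : z = x
  · subst hx
    rw [aux z y hxy h]
    simp
  by_cases hy : z = y
  · subst hy
    rw [edge_comm, aux z x hxy.symm fun h' => h h'.symm]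
    simp
  · have : (G ⊔ edge x y).neighborSet z = G.neighborSet z := by
      ext w
      simp only [mem_neighborSet, sup_adj, edge_adj]
      grind
    simp [this, hx, hy]

/-- Attaching a vertex isolated in a linear forest to a vertex of degree at most `1` gives a linear
forest. -/
lemma IsLinearForest.sup_edge {V : Type*} [Finite V] {H : SimpleGraph V} (hH : H.IsLinearForest)
    {x y : V} (hxy : x ≠ y) (hx : (H.neighborSet x).ncard ≤ 1)
    (hy : (H.neighborSet y).ncard = 0) : (H ⊔ edge x y).IsLinearForest := by
  classical
  have hy' : ∀ z, ¬ H.Adj y z := by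
    intro z hz
    have := (Set.ncard_eq_zero).1 hy
    exact Set.notMem_empty z (this ▸ (show z ∈ H.neighborSet y from hz))
  refine ⟨hH.1.sup_edge_of_not_reachable ?_, fun v => ?_⟩
  · rintro ⟨p⟩
    cases p.reverse with
    | nil => exact hxy rfl
    | cons e _ => exact hy' _ e
  · have h2 := hH.2 v
    rw [← Set.Finite.cast_ncard_eq (Set.toFinite _)] at h2 ⊢
    rw [ncard_neighborSet_sup_edge hxy fun h => hy' _ h.symm]
    norm_cast at h2 ⊢
    split_ifs with h
    · rcases h with rfl | rfl <;> omega
    · omega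

lemma HasColorDegrees.add_eq {V : Type*} [Finite V] {G : SimpleGraph V} {d : Bool → V → ℕ}
    (h : G.HasColorDegrees d) (x : V) : d true x + d false x = (G.neighborSet x).ncard := by
  obtain ⟨F, -, hdisj, rfl, hd⟩ := h
  rw [← hd, ← hd, ← Set.ncard_union_eq]
  · rfl
  · exact Set.disjoint_left.2 fun y hy hy' => disjoint_left.1 hdisj _ _ hy hy'

/-- An edge `xy` may be given the color `i` if `x` has at most one edge and `y` has no edge of that
color. -/
lemma HasColorDegrees.sup_edge {V : Type*} [Finite V] [DecidableEq V] {G : SimpleGraph V}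
    {d : Bool → V → ℕ} (h : G.HasColorDegrees d) (i : Bool) {x y : V} (hxy : x ≠ y)
    (hadj : ¬ G.Adj x y) (hx : d i x ≤ 1) (hy : d i y = 0) :
    (G ⊔ edge x y).HasColorDegrees (addColor d i x y) := by
  obtain ⟨F, hF, hdisj, rfl, hd⟩ := h
  have hadj' : ∀ j, ¬ (F j).Adj x y := by
    intro j hj
    apply hadj
    cases j
    · exact Or.inr hj
    · exact Or.inl hj
  have he : ∀ j, Disjoint (edge x y) (F j) := by
    intro j
    rw [disjoint_left]
    intro a b hab hj
    rw [edge_adj] at hab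
    rcases hab.1 with ⟨rfl, rfl⟩ | ⟨rfl, rfl⟩
    · exact hadj' j hj
    · exact hadj' j hj.symm
  refine ⟨fun j => if j = i then F j ⊔ edge x y else F j, fun j => ?_, ?_, ?_, fun j z => ?_⟩
  · dsimp only
    split_ifs with hj
    · subst hj
      exact (hF j).sup_edge hxy (by rw [hd]; exact hx) (by rw [hd]; exact hy)
    · exact hF j
  · cases i
    · simpa using ⟨hdisj, (he true).symm⟩
    · simpa using ⟨hdisj, he false⟩
  · cases i
    · simp [sup_assoc]
    · simp [sup_assoc, sup_comm]
  · dsimp only [addColor]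
    split_ifs with hj h' h'
    · rw [ncard_neighborSet_sup_edge hxy (hadj' j), hd, if_pos h'.2]
    · rw [ncard_neighborSet_sup_edge hxy (hadj' j), hd, if_neg fun h => h' ⟨hj, h⟩]
    · exact absurd h'.1 hj
    · rw [hd, add_zero]

lemma hasColorDegrees_bot {V : Type*} : (⊥ : SimpleGraph V).HasColorDegrees fun _ _ => 0 :=
  ⟨fun _ => ⊥, fun _ => ⟨isAcyclic_bot, fun v => by simp⟩, by simp,
    by simp, fun _ v => by simp⟩

/-! ### Matchings of vertices -/

/-- `M` is a matching: its edges are the pairs of vertices of which at most one may be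
monochromatic. -/
def IsPairing {V : Type*} (M : SimpleGraph V) : Prop :=
  ∀ x y z, M.Adj x y → M.Adj x z → y = z

/-- Re-pair `a` with `b`, leaving pairs disjoint from `{a, b}` unchanged. -/
lemma IsPairing.exists_insert {V : Type*} {M : SimpleGraph V} (hM : M.IsPairing) {a b : V}
    (hab : a ≠ b) : ∃ M' : SimpleGraph V, M'.IsPairing ∧ M'.Adj a b ∧
      ∀ x y, x ≠ a → x ≠ b → y ≠ a → y ≠ b → M.Adj x y → M'.Adj x y := by
  let M' : SimpleGraph V :=
    { Adj := fun x y => (x = a ∧ y = b) ∨ (x = b ∧ y = a) ∨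
        (x ≠ a ∧ x ≠ b ∧ y ≠ a ∧ y ≠ b ∧ M.Adj x y)
      symm := ⟨fun x y h => by grind [M.adj_symm]⟩
      loopless := ⟨fun x h => by grind [M.irrefl]⟩ }
  exact ⟨M', fun x y z (h : _ ∨ _) (h' : _ ∨ _) => by grind [IsPairing], .inl ⟨rfl, rfl⟩,
    fun x y h1 h2 h3 h4 h5 => .inr (.inr ⟨h1, h2, h3, h4, h5⟩)⟩

/-- Replace `v` by `u` as a partner. -/
lemma IsPairing.exists_transfer {V : Type*} {M : SimpleGraph V} (hM : M.IsPairing) (v u : V) :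
    ∃ M' : SimpleGraph V, M'.IsPairing ∧ (∀ x, x ≠ u → x ≠ v → M.Adj v x → M'.Adj u x) ∧
      ∀ x y, x ≠ u → x ≠ v → y ≠ u → y ≠ v → M.Adj x y → M'.Adj x y := by
  by_cases h : ∃ x, x ≠ u ∧ x ≠ v ∧ M.Adj v x
  · obtain ⟨x, hxu, hxv, hx⟩ := h
    let M' : SimpleGraph V :=
      { Adj := fun y z => (y = u ∧ z = x) ∨ (y = x ∧ z = u) ∨
          (y ≠ u ∧ y ≠ v ∧ z ≠ u ∧ z ≠ v ∧ M.Adj y z)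
        symm := ⟨fun x y h => by grind [M.adj_symm]⟩
        loopless := ⟨fun x h => by grind [M.irrefl]⟩ }
    exact ⟨M', fun y z w (h : _ ∨ _) (h' : _ ∨ _) => by grind [IsPairing, M.adj_symm],
      fun y _ _ hy => .inl ⟨rfl, hM _ _ _ hy hx⟩,
      fun x y h1 h2 h3 h4 h5 => .inr (.inr ⟨h1, h2, h3, h4, h5⟩)⟩
  · let M' : SimpleGraph V :=
      { Adj := fun y z => y ≠ u ∧ y ≠ v ∧ z ≠ u ∧ z ≠ v ∧ M.Adj y z
        symm := ⟨fun x y h => by grind [M.adj_symm]⟩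
        loopless := ⟨fun x h => by grind [M.irrefl]⟩ }
    exact ⟨M', fun y z w h h' => hM y z w h.2.2.2.2 h'.2.2.2.2,
      fun x h1 h2 h3 => absurd ⟨x, h1, h2, h3⟩ h,
      fun x y h1 h2 h3 h4 h5 => ⟨h1, h2, h3, h4, h5⟩⟩

/-- Remove `u` and `v` from their pairs and pair their partners instead. -/
lemma IsPairing.exists_join {V : Type*} {M : SimpleGraph V} (hM : M.IsPairing) {u v : V}
    (huv : u ≠ v) : ∃ M' : SimpleGraph V, M'.IsPairing ∧
      (∀ x y, x ≠ u → x ≠ v → y ≠ u → y ≠ v → M.Adj u x → M.Adj v y → M'.Adj x y) ∧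
      ∀ x y, x ≠ u → x ≠ v → y ≠ u → y ≠ v → M.Adj x y → M'.Adj x y := by
  let M' : SimpleGraph V :=
    { Adj := fun x y => x ≠ u ∧ x ≠ v ∧ y ≠ u ∧ y ≠ v ∧
        (M.Adj x y ∨ (M.Adj u x ∧ M.Adj v y) ∨ (M.Adj u y ∧ M.Adj v x))
      symm := ⟨fun x y h => by grind [M.adj_symm]⟩
      loopless := ⟨fun x h => by grind [M.irrefl, IsPairing, M.adj_symm]⟩ }
  refine ⟨M', ?_, fun x y h1 h2 h3 h4 h5 h6 => ⟨h1, h2, h3, h4, .inr (.inl ⟨h5, h6⟩)⟩,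
    fun x y h1 h2 h3 h4 h5 => ⟨h1, h2, h3, h4, .inl h5⟩⟩
  rintro x y z ⟨hxu, hxv, hyu, hyv, h⟩ ⟨-, -, hzu, hzv, h'⟩
  grind [IsPairing, M.adj_symm]

/-! ### Reductions -/

/-- For every pairing `M`, the graph has a decomposition into two linear forests such that at most
one vertex of each pair is monochromatic. -/
def IsPairColorable {V : Type*} (G : SimpleGraph V) : Prop :=
  ∀ M : SimpleGraph V, M.IsPairing → ∃ d, G.HasColorDegrees d ∧
    ∀ x y, M.Adj x y → ¬ (IsMono d x ∧ IsMono d y)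

/-- The graph obtained from `G` by removing all edges at vertices in `D`. -/
def isolate {V : Type*} (G : SimpleGraph V) (D : Set V) : SimpleGraph V where
  Adj x y := G.Adj x y ∧ x ∉ D ∧ y ∉ D
  symm := ⟨fun _ _ h => ⟨h.1.symm, h.2.2, h.2.1⟩⟩
  loopless := ⟨fun _ h => h.1.ne rfl⟩

lemma isolate_adj {V : Type*} {G : SimpleGraph V} {D : Set V} {x y : V} :
    (G.isolate D).Adj x y ↔ G.Adj x y ∧ x ∉ D ∧ y ∉ D := Iff.rfl

lemma isolate_le {V : Type*} (G : SimpleGraph V) (D : Set V) : G.isolate D ≤ G :=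
  fun _ _ h => h.1

lemma ncard_neighborSet_isolate_of_mem {V : Type*} (G : SimpleGraph V) {D : Set V} {x : V}
    (hx : x ∈ D) : ((G.isolate D).neighborSet x).ncard = 0 := by
  have : (G.isolate D).neighborSet x = ∅ := by
    ext y
    simp [isolate_adj, hx]
  rw [this, Set.ncard_empty]

lemma not_isMono_of_add_ne {V : Type*} {d : Bool → V → ℕ} {x : V}
    (h : d true x + d false x ≠ 2) : ¬ IsMono d x := by
  rintro ⟨i, h1, h2⟩
  cases i <;> simp at h2 <;> omega

lemma not_isMono_of_one_le {V : Type*} {d : Bool → V → ℕ} {x : V} (i : Bool)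
    (h : 1 ≤ d i x) (h' : 1 ≤ d (!i) x) : ¬ IsMono d x := by
  rintro ⟨j, h1, h2⟩
  rcases Bool.eq_or_eq_not j i with rfl | rfl
  · omega
  · simp at h2; omega

lemma isMono_congr {V : Type*} {d d' : Bool → V → ℕ} {x : V} (h : ∀ i, d' i x = d i x) :
    IsMono d' x ↔ IsMono d x := by
  simp only [IsMono, h]

lemma isMono_or_eq_one {V : Type*} {d : Bool → V → ℕ} {x : V}
    (h : d true x + d false x = 2) : IsMono d x ∨ ∀ i, d i x = 1 := by
  by_cases h1 : d true x = 1
  · exact .inr fun i => by cases i <;> omega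
  · by_cases h2 : d true x = 2
    · exact .inl ⟨true, h2, by simp; omega⟩
    · exact .inl ⟨false, by omega, by simp; omega⟩

/-- At a vertex with at most three colored edges, one of the two colors can be used for a further
edge without making the vertex monochromatic. -/
lemma exists_safe_color {n : Bool → ℕ} (h : n true + n false ≤ 3) :
    ∃ i, n i ≤ 1 ∧ (n i = 1 → 1 ≤ n (!i)) := by
  by_cases h0 : n true = 0
  · exact ⟨true, by omega, by omega⟩
  by_cases h1 : n false = 0
  · exact ⟨false, by omega, by omega⟩
  by_cases h2 : n true = 1
  · exact ⟨true, by omega, by simp; omega⟩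
  · exact ⟨false, by omega, by simp; omega⟩

/-- It suffices to check the pairs that meet the set `D` of vertices whose color degrees have
changed. -/
lemma pairs_of_agree {V : Type*} {M M' : SimpleGraph V} {d d' : Bool → V → ℕ} (D : Set V)
    (hok : ∀ x y, M'.Adj x y → ¬ (IsMono d x ∧ IsMono d y))
    (hkeep : ∀ x y, x ∉ D → y ∉ D → M.Adj x y → M'.Adj x y)
    (hagree : ∀ x, x ∉ D → ∀ i, d' i x = d i x)
    (hD : ∀ x y, x ∈ D → M.Adj x y → IsMono d' x → ¬ IsMono d' y) :
    ∀ x y, M.Adj x y → ¬ (IsMono d' x ∧ IsMono d' y) := by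
  rintro x y hxy ⟨hx, hy⟩
  by_cases hxD : x ∈ D
  · exact hD x y hxD hxy hx hy
  by_cases hyD : y ∈ D
  · exact hD y x hyD hxy.symm hy hx
  exact hok x y (hkeep x y hxD hyD hxy)
    ⟨(isMono_congr (hagree x hxD)).1 hx, (isMono_congr (hagree y hyD)).1 hy⟩

/-- Suppose that a coloring can be extended so that no vertex of `D` other than `q` is
monochromatic, and also so that none other than `p` is. If at most one of the partners of `p` and `q` was monochromatic, then one
of the extensions respects all pairs. -/
lemma pairs_of_two_options {V : Type*} {M M' : SimpleGraph V} {d d₁ d₂ : Bool → V → ℕ}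
    (D : Set V) {p q : V}
    (hok : ∀ x y, M'.Adj x y → ¬ (IsMono d x ∧ IsMono d y))
    (hkeep : ∀ x y, x ∉ D → y ∉ D → M.Adj x y → M'.Adj x y)
    (hjoin : ∀ x y, x ∉ D → y ∉ D → M.Adj p x → M.Adj q y → M'.Adj x y)
    (h₁ : ∀ x, x ∉ D → ∀ i, d₁ i x = d i x) (h₂ : ∀ x, x ∉ D → ∀ i, d₂ i x = d i x)
    (h₁' : ∀ x, x ∈ D → x ≠ q → ¬ IsMono d₁ x) (h₂' : ∀ x, x ∈ D → x ≠ p → ¬ IsMono d₂ x) :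
    (∀ x y, M.Adj x y → ¬ (IsMono d₁ x ∧ IsMono d₁ y)) ∨
      ∀ x y, M.Adj x y → ¬ (IsMono d₂ x ∧ IsMono d₂ y) := by
  by_cases h : ∃ x, x ∉ D ∧ M.Adj p x ∧ IsMono d x
  · obtain ⟨x, hxD, hpx, hx⟩ := h
    refine .inl (pairs_of_agree D hok hkeep h₁ fun z y hz hzy hzm hym => ?_)
    by_cases hzq : z = q
    · subst hzq
      by_cases hy : y ∈ D
      · exact h₁' y hy hzy.ne' hym
      · exact hok x y (hjoin x y hxD hy hpx hzy) ⟨hx, (isMono_congr (h₁ y hy)).1 hym⟩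
    · exact h₁' z hz hzq hzm
  · refine .inr (pairs_of_agree D hok hkeep h₂ fun z y hz hzy hzm hym => ?_)
    by_cases hzp : z = p
    · subst hzp
      by_cases hy : y ∈ D
      · exact h₂' y hy hzy.ne' hym
      · exact h ⟨y, hy, hzy, (isMono_congr (h₂ y hy)).1 hym⟩
    · exact h₂' z hz hzp hzm

/-- A vertex of degree `1` can be deleted: its edge gets a safe color. -/
lemma IsPairColorable.of_leaf {V : Type*} [Finite V] {G : SimpleGraph V} {v w : V}
    (hv : G.neighborSet v = {w}) (hw : (G.neighborSet w).ncard ≤ 4)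
    (h : (G.isolate {v}).IsPairColorable) : G.IsPairColorable := by
  classical
  intro M hM
  obtain ⟨d, hd, hok⟩ := h M hM
  have hvw : ∀ z, G.Adj v z ↔ z = w := fun z => by rw [← mem_neighborSet, hv]; rfl
  have hne : w ≠ v := ((hvw w).2 rfl).ne'
  have hnadj : ¬ (G.isolate {v}).Adj w v := fun h => h.2.2 rfl
  have hG : G.isolate {v} ⊔ edge w v = G := by
    ext x y
    simp only [sup_adj, isolate_adj, edge_adj, Set.mem_singleton_iff]
    grind [G.adj_symm, G.irrefl]
  have hdegw : (G.neighborSet w).ncard = ((G.isolate {v}).neighborSet w).ncard + 1 := by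
    conv_lhs => rw [← hG]
    rw [ncard_neighborSet_sup_edge hne hnadj]
    simp
  have sv := hd.add_eq v
  rw [ncard_neighborSet_isolate_of_mem G (Set.mem_singleton v)] at sv
  have sw := hd.add_eq w
  obtain ⟨α, hα, hα'⟩ := exists_safe_color (n := fun i => d i w) (by omega)
  have hdv : ∀ i, d i v = 0 := fun i => by cases i <;> omega
  refine ⟨_, hG ▸ hd.sup_edge α hne hnadj hα (hdv α), ?_⟩
  refine pairs_of_agree {v, w} hok (fun _ _ _ _ h => h) (fun x hx i => ?_) ?_
  · grind [addColor]
  · rintro x y (rfl | rfl) - ⟨i, h1, h2⟩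
    · grind [addColor]
    · exfalso
      rcases Bool.eq_or_eq_not i α with rfl | rfl
      · grind [addColor]
      · grind [addColor]

/-- Deletion of a vertex `v` of degree `2`, with neighbors `u` and `w`, lowers the degrees of `u`
and `w` by one. -/
lemma ncard_neighborSet_isolate_singleton {V : Type*} [Finite V] [DecidableEq V]
    {G : SimpleGraph V} {v u w : V} (huw : u ≠ w) (hv : G.neighborSet v = {u, w}) :
    G.isolate {v} ⊔ edge w v ⊔ edge u v = G ∧
    (G.neighborSet w).ncard = ((G.isolate {v}).neighborSet w).ncard + 1 ∧
    (G.neighborSet u).ncard = ((G.isolate {v}).neighborSet u).ncard + 1 := by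
  have hadj : ∀ z, G.Adj v z ↔ z = u ∨ z = w := fun z => by rw [← mem_neighborSet, hv]; rfl
  have hwv : w ≠ v := ((hadj w).2 (.inr rfl)).ne'
  have huv : u ≠ v := ((hadj u).2 (.inl rfl)).ne'
  have hG : G.isolate {v} ⊔ edge w v ⊔ edge u v = G := by
    ext x y
    simp only [sup_adj, isolate_adj, edge_adj, Set.mem_singleton_iff]
    grind [G.adj_symm, G.irrefl]
  have h1 : ¬ (G.isolate {v}).Adj w v := fun h => h.2.2 rfl
  have h2 : ¬ (G.isolate {v} ⊔ edge w v).Adj u v := by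
    simp only [sup_adj, isolate_adj, edge_adj, Set.mem_singleton_iff]
    grind
  refine ⟨hG, ?_, ?_⟩
  · conv_lhs => rw [← hG]
    rw [ncard_neighborSet_sup_edge huv h2, ncard_neighborSet_sup_edge hwv h1]
    grind
  · conv_lhs => rw [← hG]
    rw [ncard_neighborSet_sup_edge huv h2, ncard_neighborSet_sup_edge hwv h1]
    grind

/-- A vertex `v` of degree `2` with a neighbor `u` of degree `2` can be deleted. The edge from `v`
to its other neighbor `w` gets a safe color. The color of `uv` can be chosen such that neither of
`u` and `v` is monochromatic, or otherwise such that only `u` or only `v` is; so the partners of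
`u` and `v` are paired in the smaller graph. -/
lemma IsPairColorable.of_adj_degree_two {V : Type*} [Finite V] {G : SimpleGraph V} {v u w : V}
    (huw : u ≠ w) (hv : G.neighborSet v = {u, w}) (hu : (G.neighborSet u).ncard = 2)
    (hw : (G.neighborSet w).ncard ≤ 4)
    (h : (G.isolate {v}).IsPairColorable) : G.IsPairColorable := by
  classical
  intro M hM
  obtain ⟨hG, hdw, hdu⟩ := ncard_neighborSet_isolate_singleton huw hv
  have hadj : ∀ z, G.Adj v z ↔ z = u ∨ z = w := fun z => by rw [← mem_neighborSet, hv]; rfl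
  have hwv : w ≠ v := ((hadj w).2 (.inr rfl)).ne'
  have huv : u ≠ v := ((hadj u).2 (.inl rfl)).ne'
  obtain ⟨M', hM', hjoin, hkeep⟩ := hM.exists_join huv
  obtain ⟨d, hd, hok⟩ := h M' hM'
  have sv := hd.add_eq v
  rw [ncard_neighborSet_isolate_of_mem G (Set.mem_singleton v)] at sv
  have sw := hd.add_eq w
  have su := hd.add_eq u
  obtain ⟨α, hα, hα'⟩ := exists_safe_color (n := fun i => d i w) (by omega)
  have hdv : ∀ i, d i v = 0 := fun i => by cases i <;> omega
  have h1 : ¬ (G.isolate {v}).Adj w v := fun h => h.2.2 rfl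
  have h2 : ¬ (G.isolate {v} ⊔ edge w v).Adj u v := by
    simp only [sup_adj, isolate_adj, edge_adj, Set.mem_singleton_iff]
    grind
  have s1 := hd.sup_edge α hwv h1 hα (hdv α)
  have hu1 : d α u + d (!α) u = 1 := by cases α <;> simp <;> omega
  -- The coloring in which `v` is not monochromatic.
  have s2 := s1.sup_edge (!α) huv h2 (by grind [addColor]) (by grind [addColor])
  rw [hG] at s2
  by_cases hb : d α u = 1
  · refine ⟨_, s2, pairs_of_agree {u, v, w} hok ?_ (fun x hx i => ?_) ?_⟩
    · intro x y hx hy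
      simp only [Set.mem_insert_iff, Set.mem_singleton_iff, not_or] at hx hy
      exact hkeep x y hx.1 hx.2.1 hy.1 hy.2.1
    · grind [addColor]
    · rintro x y hx - ⟨i, h1, h2⟩
      exfalso
      rcases Bool.eq_or_eq_not i α with rfl | rfl <;> rcases hx with rfl | rfl | rfl <;>
        grind [addColor]
  · have s3 := s1.sup_edge α huv.symm (fun h => h2 h.symm) (by grind [addColor])
      (by grind [addColor])
    rw [edge_comm v u, hG] at s3
    have := pairs_of_two_options (M := M) (p := v) (q := u)
      (d₁ := addColor (addColor d α w v) (!α) u v)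
      (d₂ := addColor (addColor d α w v) α v u) {u, v, w} hok ?_ ?_ ?_ ?_ ?_ ?_
    · rcases this with h | h
      · exact ⟨_, s2, h⟩
      · exact ⟨_, s3, h⟩
    · intro x y hx hy
      simp only [Set.mem_insert_iff, Set.mem_singleton_iff, not_or] at hx hy
      exact hkeep x y hx.1 hx.2.1 hy.1 hy.2.1
    · intro x y hx hy hvx huy
      simp only [Set.mem_insert_iff, Set.mem_singleton_iff, not_or] at hx hy
      exact (hjoin y x hy.1 hy.2.1 hx.1 hx.2.1 huy hvx).symm
    · intro x hx i
      grind [addColor]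
    · intro x hx i
      grind [addColor]
    · rintro x hx hne ⟨i, h1, h2⟩
      rcases Bool.eq_or_eq_not i α with rfl | rfl <;> rcases hx with rfl | rfl | rfl <;>
        grind [addColor]
    · rintro x hx hne ⟨i, h1, h2⟩
      rcases Bool.eq_or_eq_not i α with rfl | rfl <;> rcases hx with rfl | rfl | rfl <;>
        grind [addColor]

/-- A vertex `v` of degree `2` with a neighbor `u` of degree `3` can be deleted. The edge from `v`
to its other neighbor `w` gets a safe color `α`. The edge `uv` gets the other color, unless `u` is
monochromatic in that color before the extension; then `v` becomes monochromatic. So `u` is paired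
with the partner of `v` in the smaller graph. -/
lemma IsPairColorable.of_adj_degree_three {V : Type*} [Finite V] {G : SimpleGraph V} {v u w : V}
    (huw : u ≠ w) (hv : G.neighborSet v = {u, w}) (hu : (G.neighborSet u).ncard = 3)
    (hw : (G.neighborSet w).ncard ≤ 4)
    (h : (G.isolate {v}).IsPairColorable) : G.IsPairColorable := by
  classical
  intro M hM
  obtain ⟨hG, hdw, hdu⟩ := ncard_neighborSet_isolate_singleton huw hv
  have hadj : ∀ z, G.Adj v z ↔ z = u ∨ z = w := fun z => by rw [← mem_neighborSet, hv]; rfl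
  have hwv : w ≠ v := ((hadj w).2 (.inr rfl)).ne'
  have huv : u ≠ v := ((hadj u).2 (.inl rfl)).ne'
  obtain ⟨M', hM', htrans, hkeep⟩ := hM.exists_transfer v u
  obtain ⟨d, hd, hok⟩ := h M' hM'
  have sv := hd.add_eq v
  rw [ncard_neighborSet_isolate_of_mem G (Set.mem_singleton v)] at sv
  have sw := hd.add_eq w
  have su := hd.add_eq u
  obtain ⟨α, hα, hα'⟩ := exists_safe_color (n := fun i => d i w) (by omega)
  have hdv : ∀ i, d i v = 0 := fun i => by cases i <;> omega
  have h1 : ¬ (G.isolate {v}).Adj w v := fun h => h.2.2 rfl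
  have h2 : ¬ (G.isolate {v} ⊔ edge w v).Adj u v := by
    simp only [sup_adj, isolate_adj, edge_adj, Set.mem_singleton_iff]
    grind
  have s1 := hd.sup_edge α hwv h1 hα (hdv α)
  have hu2 : d α u + d (!α) u = 2 := by cases α <;> simp <;> omega
  have hkeep' : ∀ x y, x ∉ ({u, v, w} : Set V) → y ∉ ({u, v, w} : Set V) → M.Adj x y →
      M'.Adj x y := by
    intro x y hx hy
    simp only [Set.mem_insert_iff, Set.mem_singleton_iff, not_or] at hx hy
    exact hkeep x y hx.1 hx.2.1 hy.1 hy.2.1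
  by_cases hb : d (!α) u = 2
  · have s2 := s1.sup_edge α huv.symm (fun h => h2 h.symm) (by grind [addColor])
      (by grind [addColor])
    rw [edge_comm v u, hG] at s2
    have agree : ∀ x, x ∉ ({u, v, w} : Set V) → ∀ i,
        addColor (addColor d α w v) α v u i x = d i x := by
      intro x hx i
      grind [addColor]
    have hu' : ¬ IsMono (addColor (addColor d α w v) α v u) u :=
      not_isMono_of_add_ne (by rw [s2.add_eq]; omega)
    have hw' : ¬ IsMono (addColor (addColor d α w v) α v u) w := by
      rintro ⟨i, h1, h2⟩
      rcases Bool.eq_or_eq_not i α with rfl | rfl <;> grind [addColor]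
    have humono : IsMono d u := ⟨!α, hb, by simp; omega⟩
    refine ⟨_, s2, pairs_of_agree {u, v, w} hok hkeep' agree ?_⟩
    rintro x y (rfl | rfl | rfl) hxy hxm hym
    · exact hu' hxm
    · by_cases hy : y ∈ ({u, x, w} : Set V)
      · rcases hy with rfl | rfl | rfl
        · exact hu' hym
        · exact hxy.ne rfl
        · exact hw' hym
      · have hy' := hy
        simp only [Set.mem_insert_iff, Set.mem_singleton_iff, not_or] at hy'
        exact hok u y (htrans y hy'.1 hy'.2.1 hxy) ⟨humono, (isMono_congr (agree y hy)).1 hym⟩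
    · exact hw' hxm
  · have s2 := s1.sup_edge (!α) huv h2 (by grind [addColor]) (by grind [addColor])
    rw [hG] at s2
    have hu' := not_isMono_of_add_ne (d := addColor (addColor d α w v) (!α) u v) (x := u)
      (by rw [s2.add_eq]; omega)
    refine ⟨_, s2, pairs_of_agree {u, v, w} hok hkeep' (fun x hx i => ?_) ?_⟩
    · grind [addColor]
    · rintro x y (rfl | hx) - hxm
      · exact absurd hxm hu'
      · obtain ⟨i, h1, h2⟩ := hxm
        exfalso
        rcases Bool.eq_or_eq_not i α with rfl | rfl <;> rcases hx with rfl | rfl <;>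
          grind [addColor]

/-- Extension over two vertices `p` and `q` with the same two neighbors, given that at most one of
these was monochromatic: if neither was, then `p` and `q` can both be made bichromatic, and
otherwise at least `p` can. -/
lemma HasColorDegrees.exists_extend_twins {V : Type*} [Finite V] {H : SimpleGraph V}
    {d : Bool → V → ℕ} (hd : H.HasColorDegrees d) {a b p q : V} (hab : a ≠ b) (hpq : p ≠ q)
    (hap : a ≠ p) (haq : a ≠ q) (hbp : b ≠ p) (hbq : b ≠ q)
    (hp : ∀ z, ¬ H.Adj z p) (hq : ∀ z, ¬ H.Adj z q)
    (hdp : ∀ i, d i p = 0) (hdq : ∀ i, d i q = 0)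
    (ha : d true a + d false a = 2) (hb : d true b + d false b = 2)
    (hmono : ¬ (IsMono d a ∧ IsMono d b)) :
    ∃ d', (H ⊔ edge a p ⊔ edge b p ⊔ edge a q ⊔ edge b q).HasColorDegrees d' ∧
      (∀ x, x ∉ ({a, b, p, q} : Set V) → ∀ i, d' i x = d i x) ∧ ¬ IsMono d' p := by
  classical
  wlog hbm : ∀ i, d i b = 1 generalizing a b
  · have hbm' := (isMono_or_eq_one hb).resolve_right hbm
    have ham := (isMono_or_eq_one ha).resolve_left fun h => hmono ⟨h, hbm'⟩
    obtain ⟨d', h1, h2, h3⟩ := this hab.symm hbp hbq hap haq hb ha (fun h => hmono h.symm) ham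
    have e : H ⊔ edge b p ⊔ edge a p ⊔ edge b q ⊔ edge a q =
        H ⊔ edge a p ⊔ edge b p ⊔ edge a q ⊔ edge b q := by
      ac_rfl
    exact ⟨d', e ▸ h1, fun x hx => h2 x (by rwa [Set.insert_comm]), h3⟩
  rcases isMono_or_eq_one ha with ⟨i, hi, hi'⟩ | ham
  · -- All edges at `a` get the color `!i`; this color is also used for `bq`.
    have s1 := hd.sup_edge (!i) (x := b) (y := q) hbq (hq b) (by grind) (by grind)
    have s2 := s1.sup_edge (!i) (x := q) (y := a) haq.symm
      (by simp only [sup_adj, edge_adj]; grind [H.adj_symm]) (by grind [addColor])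
      (by grind [addColor])
    have s3 := s2.sup_edge (!i) (x := a) (y := p) hap
      (by simp only [sup_adj, edge_adj]; grind) (by grind [addColor])
      (by grind [addColor])
    have s4 := s3.sup_edge i (x := b) (y := p) hbp
      (by simp only [sup_adj, edge_adj]; grind) (by grind [addColor])
      (by grind [addColor])
    have e : H ⊔ edge b q ⊔ edge q a ⊔ edge a p ⊔ edge b p =
        H ⊔ edge a p ⊔ edge b p ⊔ edge a q ⊔ edge b q := by
      rw [edge_comm q a]
      ac_rfl
    refine ⟨_, e ▸ s4, fun x hx j => by grind [addColor], not_isMono_of_one_le i ?_ ?_⟩ <;>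
      grind [addColor]
  · have s1 := hd.sup_edge true (x := a) (y := p) hap (hp a) (by grind) (by grind)
    have s2 := s1.sup_edge false (x := b) (y := p) hbp
      (by simp only [sup_adj, edge_adj]; grind) (by grind [addColor]) (by grind [addColor])
    have s3 := s2.sup_edge false (x := a) (y := q) haq
      (by simp only [sup_adj, edge_adj]; grind) (by grind [addColor]) (by grind [addColor])
    have s4 := s3.sup_edge true (x := b) (y := q) hbq
      (by simp only [sup_adj, edge_adj]; grind) (by grind [addColor]) (by grind [addColor])
    refine ⟨_, s4, fun x hx j => by grind [addColor], not_isMono_of_one_le true ?_ ?_⟩ <;>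
      grind [addColor]

/-- Two vertices `p` and `q` of degree `2` with the same neighbors `a` and `b` of degree `4` can be
deleted. In the smaller graph `a` is paired with `b`, since four edges of the same color would form
a cycle, and the partner of `p` with the partner of `q`. -/
lemma IsPairColorable.of_twins {V : Type*} [Finite V] {G : SimpleGraph V} {a b p q : V}
    (hab : a ≠ b) (hpq : p ≠ q) (hp : G.neighborSet p = {a, b}) (hq : G.neighborSet q = {a, b})
    (ha : (G.neighborSet a).ncard = 4) (hb : (G.neighborSet b).ncard = 4)
    (h : (G.isolate {p, q}).IsPairColorable) : G.IsPairColorable := by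
  classical
  intro M hM
  obtain ⟨M₁, hM₁, hjoin, hkeep⟩ := hM.exists_join hpq
  obtain ⟨M', hM', hins, hkeep'⟩ := hM₁.exists_insert hab
  obtain ⟨d, hd, hok⟩ := h M' hM'
  have hp' : ∀ z, G.Adj p z ↔ z = a ∨ z = b := fun z => by rw [← mem_neighborSet, hp]; rfl
  have hq' : ∀ z, G.Adj q z ↔ z = a ∨ z = b := fun z => by rw [← mem_neighborSet, hq]; rfl
  have hap : a ≠ p := ((hp' a).2 (.inl rfl)).ne'
  have haq : a ≠ q := ((hq' a).2 (.inl rfl)).ne'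
  have hbp : b ≠ p := ((hp' b).2 (.inr rfl)).ne'
  have hbq : b ≠ q := ((hq' b).2 (.inr rfl)).ne'
  have np : ∀ z, ¬ (G.isolate {p, q}).Adj z p := fun z h => h.2.2 (.inl rfl)
  have nq : ∀ z, ¬ (G.isolate {p, q}).Adj z q := fun z h => h.2.2 (.inr rfl)
  have hG : G.isolate {p, q} ⊔ edge a p ⊔ edge b p ⊔ edge a q ⊔ edge b q = G := by
    ext x y
    simp only [sup_adj, isolate_adj, edge_adj, Set.mem_insert_iff, Set.mem_singleton_iff]
    grind [G.adj_symm, G.irrefl]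
  have hdeg : ∀ z, (G.neighborSet z).ncard = ((G.isolate {p, q}).neighborSet z).ncard +
      (if z = a ∨ z = p then 1 else 0) + (if z = b ∨ z = p then 1 else 0) +
      (if z = a ∨ z = q then 1 else 0) + (if z = b ∨ z = q then 1 else 0) := by
    intro z
    conv_lhs => rw [← hG]
    rw [ncard_neighborSet_sup_edge hbq, ncard_neighborSet_sup_edge haq,
      ncard_neighborSet_sup_edge hbp, ncard_neighborSet_sup_edge hap (np a)] <;>
    · simp only [sup_adj, edge_adj]
      grind
  have sa := hd.add_eq a
  have sb := hd.add_eq b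
  have sp := hd.add_eq p
  have sq := hd.add_eq q
  rw [ncard_neighborSet_isolate_of_mem G (.inl rfl)] at sp
  rw [ncard_neighborSet_isolate_of_mem G (.inr rfl)] at sq
  have hdp : ∀ i, d i p = 0 := fun i => by cases i <;> omega
  have hdq : ∀ i, d i q = 0 := fun i => by cases i <;> omega
  have ha2 : d true a + d false a = 2 := by grind
  have hb2 : d true b + d false b = 2 := by grind
  obtain ⟨d₁, s₁, agree₁, n₁⟩ := hd.exists_extend_twins hab hpq hap haq hbp hbq np nq hdp hdq
    ha2 hb2 (hok a b hins)
  obtain ⟨d₂, s₂, agree₂, n₂⟩ := hd.exists_extend_twins hab hpq.symm haq hap hbq hbp nq np hdq hdp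
    ha2 hb2 (hok a b hins)
  rw [hG] at s₁
  have e : G.isolate {p, q} ⊔ edge a q ⊔ edge b q ⊔ edge a p ⊔ edge b p =
      G.isolate {p, q} ⊔ edge a p ⊔ edge b p ⊔ edge a q ⊔ edge b q := by
    ac_rfl
  rw [e, hG] at s₂
  have := pairs_of_two_options (M := M) (p := p) (q := q) (d₁ := d₁) (d₂ := d₂) {a, b, p, q}
    hok ?_ ?_ agree₁ (fun x hx => agree₂ x (by rwa [Set.pair_comm q p])) ?_ ?_
  · rcases this with h | h
    · exact ⟨_, s₁, h⟩
    · exact ⟨_, s₂, h⟩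
  · intro x y hx hy hxy
    simp only [Set.mem_insert_iff, Set.mem_singleton_iff, not_or] at hx hy
    grind
  · intro x y hx hy hpx hqy
    simp only [Set.mem_insert_iff, Set.mem_singleton_iff, not_or] at hx hy
    grind
  · rintro x (rfl | rfl | rfl | rfl) hne
    · exact not_isMono_of_add_ne (by rw [s₁.add_eq]; omega)
    · exact not_isMono_of_add_ne (by rw [s₁.add_eq]; omega)
    · exact n₁
    · exact absurd rfl hne
  · rintro x (rfl | rfl | rfl | rfl) hne
    · exact not_isMono_of_add_ne (by rw [s₂.add_eq]; omega)
    · exact not_isMono_of_add_ne (by rw [s₂.add_eq]; omega)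
    · exact absurd rfl hne
    · exact n₂

/-- Extension over two triangles `w u₁ v₁` and `w u₂ v₂`, where `w`, `v₁`, `v₂` are isolated before.
In each triangle either `uᵢ` was bichromatic, and then `vᵢ` can be made bichromatic with both edges
from `w` to the triangle having one color, or `uᵢ` was monochromatic, and then these edges get
different colors. So a monochromatic `vᵢ` is only needed to balance the colors at `w` when
exactly one of `u₁` and `u₂`, namely the other one, was monochromatic. -/
lemma HasColorDegrees.exists_extend_triangles {V : Type*} [Finite V] {H : SimpleGraph V}
    {d : Bool → V → ℕ} (hd : H.HasColorDegrees d) {w v₁ v₂ u₁ u₂ : V}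
    (hdist : [w, v₁, v₂, u₁, u₂].Nodup) (hw : ∀ z, ¬ H.Adj z w)
    (hv₁ : ∀ z, ¬ H.Adj z v₁) (hv₂ : ∀ z, ¬ H.Adj z v₂)
    (hdw : ∀ i, d i w = 0) (hd₁ : ∀ i, d i v₁ = 0) (hd₂ : ∀ i, d i v₂ = 0)
    (hu₁ : d true u₁ + d false u₁ = 2) (hu₂ : d true u₂ + d false u₂ = 2) :
    ∃ d', (H ⊔ edge w u₁ ⊔ edge u₁ v₁ ⊔ edge w v₁ ⊔ edge w u₂ ⊔ edge u₂ v₂ ⊔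
        edge w v₂).HasColorDegrees d' ∧
      (∀ x, x ∉ ({w, v₁, v₂, u₁, u₂} : Set V) → ∀ i, d' i x = d i x) ∧
      (IsMono d' v₁ → IsMono d u₂) ∧ (IsMono d' v₂ → IsMono d u₁) ∧
      ¬ (IsMono d' v₁ ∧ IsMono d' v₂) := by
  classical
  wlog hD : IsMono d u₂ → IsMono d u₁ generalizing v₁ v₂ u₁ u₂
  · obtain ⟨d', h1, h2, h3, h4, h5⟩ := this (v₁ := v₂) (v₂ := v₁) (by grind) hv₂ hv₁ hd₂ hd₁
      hu₂ hu₁ (fun h => by_contra fun h' => hD fun _ => h)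
    have e : H ⊔ edge w u₂ ⊔ edge u₂ v₂ ⊔ edge w v₂ ⊔ edge w u₁ ⊔ edge u₁ v₁ ⊔ edge w v₁ =
        H ⊔ edge w u₁ ⊔ edge u₁ v₁ ⊔ edge w v₁ ⊔ edge w u₂ ⊔ edge u₂ v₂ ⊔ edge w v₂ := by
      ac_rfl
    refine ⟨d', e ▸ h1, fun x hx => h2 x ?_, h4, h3, fun h => h5 h.symm⟩
    grind
  simp only [List.nodup_cons, List.mem_cons, List.not_mem_nil, or_false, not_or,
    List.nodup_nil, and_true, not_false_eq_true] at hdist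
  obtain ⟨⟨hwv₁, hwv₂, hwu₁, hwu₂⟩, ⟨hv₁v₂, hv₁u₁, hv₁u₂⟩, ⟨hv₂u₁, hv₂u₂⟩, hu₁u₂⟩ := hdist
  rcases isMono_or_eq_one hu₁ with hm₁ | hb₁
  · obtain ⟨i, hi, hi'⟩ := id hm₁
    rcases isMono_or_eq_one hu₂ with ⟨j, hj, hj'⟩ | hb₂
    · have s1 := hd.sup_edge (!i) (x := w) (y := u₁) hwu₁ (by grind [H.adj_symm]) (by grind)
        (by grind)
      have s2 := s1.sup_edge (!i) (x := u₁) (y := v₁) (Ne.symm hv₁u₁)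
        (by simp only [sup_adj, edge_adj]; grind) (by grind (ematch := 10) [addColor])
        (by grind (ematch := 10) [addColor])
      have s3 := s2.sup_edge i (x := w) (y := v₁) hwv₁
        (by simp only [sup_adj, edge_adj]; grind) (by grind (ematch := 10) [addColor])
        (by grind (ematch := 10) [addColor])
      have s4 := s3.sup_edge (!j) (x := w) (y := u₂) hwu₂
        (by simp only [sup_adj, edge_adj]; grind [H.adj_symm]) (by grind (ematch := 10) [addColor])
        (by grind (ematch := 10) [addColor])
      have s5 := s4.sup_edge (!j) (x := u₂) (y := v₂) (Ne.symm hv₂u₂)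
        (by simp only [sup_adj, edge_adj]; grind) (by grind (ematch := 10) [addColor])
        (by grind (ematch := 10) [addColor])
      have s6 := s5.sup_edge j (x := w) (y := v₂) hwv₂
        (by simp only [sup_adj, edge_adj]; grind) (by grind (ematch := 10) [addColor])
        (by grind (ematch := 10) [addColor])
      refine ⟨_, s6, fun x hx k => ?_,
        fun h => absurd h (not_isMono_of_one_le i ?_ ?_),
        fun h => absurd h (not_isMono_of_one_le j ?_ ?_),
        fun h => absurd h.1 (not_isMono_of_one_le i ?_ ?_)⟩
      · simp only [Set.mem_insert_iff, Set.mem_singleton_iff, not_or] at hx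
        simp [addColor, hx]
      all_goals grind (ematch := 10) [addColor]
    · -- The edges from `w` to the first triangle have different colors, so `wu₂` and `wv₂` have to
      -- get different colors too. This makes `v₂` monochromatic.
      have s1 := hd.sup_edge i (x := u₂) (y := w) (Ne.symm hwu₂) (by grind) (by grind)
        (by grind)
      have s2 := s1.sup_edge (!i) (x := u₂) (y := v₂) (Ne.symm hv₂u₂)
        (by simp only [sup_adj, edge_adj]; grind) (by grind (ematch := 10) [addColor])
        (by grind (ematch := 10) [addColor])
      have s3 := s2.sup_edge (!i) (x := v₂) (y := w) (Ne.symm hwv₂)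
        (by simp only [sup_adj, edge_adj]; grind) (by grind (ematch := 10) [addColor])
        (by grind (ematch := 10) [addColor])
      have s4 := s3.sup_edge (!i) (x := w) (y := u₁) hwu₁
        (by simp only [sup_adj, edge_adj]; grind [H.adj_symm]) (by grind (ematch := 10) [addColor])
        (by grind (ematch := 10) [addColor])
      have s5 := s4.sup_edge (!i) (x := u₁) (y := v₁) (Ne.symm hv₁u₁)
        (by simp only [sup_adj, edge_adj]; grind) (by grind (ematch := 10) [addColor])
        (by grind (ematch := 10) [addColor])
      have s6 := s5.sup_edge i (x := w) (y := v₁) hwv₁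
        (by simp only [sup_adj, edge_adj]; grind) (by grind (ematch := 10) [addColor])
        (by grind (ematch := 10) [addColor])
      have e : H ⊔ edge u₂ w ⊔ edge u₂ v₂ ⊔ edge v₂ w ⊔ edge w u₁ ⊔ edge u₁ v₁ ⊔ edge w v₁ =
          H ⊔ edge w u₁ ⊔ edge u₁ v₁ ⊔ edge w v₁ ⊔ edge w u₂ ⊔ edge u₂ v₂ ⊔ edge w v₂ := by
        rw [edge_comm u₂ w, edge_comm v₂ w]
        ac_rfl
      refine ⟨_, e ▸ s6, fun x hx k => ?_,
        fun h => absurd h (not_isMono_of_one_le i ?_ ?_),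
        fun _ => hm₁,
        fun h => absurd h.1 (not_isMono_of_one_le i ?_ ?_)⟩
      · simp only [Set.mem_insert_iff, Set.mem_singleton_iff, not_or] at hx
        simp [addColor, hx]
      all_goals grind (ematch := 10) [addColor]
  · -- Both edges from `w` to the first triangle are `true`, both to the second one are `false`.
    have hb₂ := (isMono_or_eq_one hu₂).resolve_left fun h => by
      obtain ⟨i, hi, -⟩ := hD h
      have := hb₁ i
      omega
    have s1 := hd.sup_edge true (x := u₁) (y := w) (Ne.symm hwu₁) (by grind) (by grind)
      (by grind)
    have s2 := s1.sup_edge false (x := u₁) (y := v₁) (Ne.symm hv₁u₁)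
      (by simp only [sup_adj, edge_adj]; grind) (by grind (ematch := 10) [addColor])
      (by grind (ematch := 10) [addColor])
    have s3 := s2.sup_edge true (x := w) (y := v₁) hwv₁
      (by simp only [sup_adj, edge_adj]; grind) (by grind (ematch := 10) [addColor])
      (by grind (ematch := 10) [addColor])
    have s4 := s3.sup_edge false (x := u₂) (y := w) (Ne.symm hwu₂)
      (by simp only [sup_adj, edge_adj]; grind) (by grind (ematch := 10) [addColor])
      (by grind (ematch := 10) [addColor])
    have s5 := s4.sup_edge true (x := u₂) (y := v₂) (Ne.symm hv₂u₂)
      (by simp only [sup_adj, edge_adj]; grind) (by grind (ematch := 10) [addColor])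
      (by grind (ematch := 10) [addColor])
    have s6 := s5.sup_edge false (x := w) (y := v₂) hwv₂
      (by simp only [sup_adj, edge_adj]; grind) (by grind (ematch := 10) [addColor])
      (by grind (ematch := 10) [addColor])
    rw [edge_comm u₁ w, edge_comm u₂ w] at s6
    refine ⟨_, s6, fun x hx k => ?_,
      fun h => absurd h (not_isMono_of_one_le true ?_ ?_),
      fun h => absurd h (not_isMono_of_one_le true ?_ ?_),
      fun h => absurd h.1 (not_isMono_of_one_le true ?_ ?_)⟩
    · simp only [Set.mem_insert_iff, Set.mem_singleton_iff, not_or] at hx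
      simp [addColor, hx]
    all_goals grind (ematch := 10) [addColor]

/-- A vertex `w` of degree `4` shared by two triangles `w u₁ v₁` and `w u₂ v₂`, with `v₁` and `v₂`
of degree `2` and `u₁` and `u₂` of degree `4`, can be deleted together with `v₁` and `v₂`. In the
smaller graph `u₁` is paired with the partner of `v₂`, and `u₂` with the partner of `v₁`. -/
lemma IsPairColorable.of_triangles {V : Type*} [Finite V] {G : SimpleGraph V} {w v₁ v₂ u₁ u₂ : V}
    (hv : v₁ ≠ v₂) (hu : u₁ ≠ u₂) (hw : G.neighborSet w = {v₁, v₂, u₁, u₂})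
    (hv₁ : G.neighborSet v₁ = {w, u₁}) (hv₂ : G.neighborSet v₂ = {w, u₂})
    (hcw : (G.neighborSet w).ncard = 4)
    (hc₁ : (G.neighborSet u₁).ncard = 4) (hc₂ : (G.neighborSet u₂).ncard = 4)
    (h : (G.isolate {w, v₁, v₂}).IsPairColorable) : G.IsPairColorable := by
  classical
  intro M hM
  have aw : ∀ z, G.Adj w z ↔ z = v₁ ∨ z = v₂ ∨ z = u₁ ∨ z = u₂ :=
    fun z => by rw [← mem_neighborSet, hw]; rfl
  have a₁ : ∀ z, G.Adj v₁ z ↔ z = w ∨ z = u₁ := fun z => by rw [← mem_neighborSet, hv₁]; rfl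
  have a₂ : ∀ z, G.Adj v₂ z ↔ z = w ∨ z = u₂ := fun z => by rw [← mem_neighborSet, hv₂]; rfl
  have hwv₁ : w ≠ v₁ := ((aw v₁).2 (by simp)).ne
  have hwv₂ : w ≠ v₂ := ((aw v₂).2 (by simp)).ne
  have hwu₁ : w ≠ u₁ := ((aw u₁).2 (by simp)).ne
  have hwu₂ : w ≠ u₂ := ((aw u₂).2 (by simp)).ne
  have hv₁u₁ : v₁ ≠ u₁ := ((a₁ u₁).2 (by simp)).ne
  have hv₂u₂ : v₂ ≠ u₂ := ((a₂ u₂).2 (by simp)).ne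
  -- The degrees of `v₁` and `u₂` differ, as do those of `v₂` and `u₁`.
  have hv₁u₂ : v₁ ≠ u₂ := by
    rintro rfl
    rw [hv₁, Set.ncard_pair hwu₁] at hc₂
    omega
  have hv₂u₁ : v₂ ≠ u₁ := by
    rintro rfl
    rw [hv₂, Set.ncard_pair hwu₂] at hc₁
    omega
  obtain ⟨M₁, hM₁, htrans₁, hkeep₁⟩ := hM.exists_transfer v₂ u₁
  obtain ⟨M', hM', htrans₂, hkeep₂⟩ := hM₁.exists_transfer v₁ u₂
  obtain ⟨d, hd, hok⟩ := h M' hM'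
  have nw : ∀ z, ¬ (G.isolate {w, v₁, v₂}).Adj z w := fun z h => h.2.2 (.inl rfl)
  have n₁ : ∀ z, ¬ (G.isolate {w, v₁, v₂}).Adj z v₁ := fun z h => h.2.2 (.inr (.inl rfl))
  have n₂ : ∀ z, ¬ (G.isolate {w, v₁, v₂}).Adj z v₂ := fun z h => h.2.2 (.inr (.inr rfl))
  have hG : G.isolate {w, v₁, v₂} ⊔ edge w u₁ ⊔ edge u₁ v₁ ⊔ edge w v₁ ⊔ edge w u₂ ⊔
      edge u₂ v₂ ⊔ edge w v₂ = G := by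
    ext x y
    simp only [sup_adj, isolate_adj, edge_adj, Set.mem_insert_iff, Set.mem_singleton_iff]
    grind [G.adj_symm, G.irrefl]
  have hdeg : ∀ z, (G.neighborSet z).ncard = ((G.isolate {w, v₁, v₂}).neighborSet z).ncard +
      (if z = w ∨ z = u₁ then 1 else 0) + (if z = u₁ ∨ z = v₁ then 1 else 0) +
      (if z = w ∨ z = v₁ then 1 else 0) + (if z = w ∨ z = u₂ then 1 else 0) +
      (if z = u₂ ∨ z = v₂ then 1 else 0) + (if z = w ∨ z = v₂ then 1 else 0) := by
    intro z
    conv_lhs => rw [← hG]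
    rw [ncard_neighborSet_sup_edge hwv₂, ncard_neighborSet_sup_edge hv₂u₂.symm,
      ncard_neighborSet_sup_edge hwu₂, ncard_neighborSet_sup_edge hwv₁,
      ncard_neighborSet_sup_edge hv₁u₁.symm,
      ncard_neighborSet_sup_edge hwu₁ fun h => nw _ h.symm] <;>
    · simp only [sup_adj, edge_adj]
      grind [adj_symm]
  have sw := hd.add_eq w
  have s₁ := hd.add_eq v₁
  have s₂ := hd.add_eq v₂
  have t₁ := hd.add_eq u₁
  have t₂ := hd.add_eq u₂
  rw [ncard_neighborSet_isolate_of_mem G (by simp)] at sw s₁ s₂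
  obtain ⟨d', hd', agree, m₁, m₂, m⟩ := hd.exists_extend_triangles
    (w := w) (v₁ := v₁) (v₂ := v₂) (u₁ := u₁) (u₂ := u₂) (by simp; grind) nw n₁ n₂
    (fun i => by cases i <;> omega) (fun i => by cases i <;> omega)
    (fun i => by cases i <;> omega) (by grind) (by grind)
  rw [hG] at hd'
  have four : ∀ x, (G.neighborSet x).ncard = 4 → ¬ IsMono d' x := fun x hx =>
    not_isMono_of_add_ne (by rw [hd'.add_eq]; omega)
  refine ⟨d', hd', pairs_of_agree {w, v₁, v₂, u₁, u₂} hok ?_ agree ?_⟩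
  · intro x y hx hy hxy
    simp only [Set.mem_insert_iff, Set.mem_singleton_iff, not_or] at hx hy
    grind
  · intro x y hx hxy hxm hym
    by_cases hy : y ∈ ({w, v₁, v₂, u₁, u₂} : Set V)
    · rcases hx with rfl | rfl | rfl | rfl | rfl <;>
        rcases hy with rfl | rfl | rfl | rfl | rfl <;>
        first
        | exact four _ hcw hxm
        | exact four _ hc₁ hxm
        | exact four _ hc₂ hxm
        | exact four _ hcw hym
        | exact four _ hc₁ hym
        | exact four _ hc₂ hym
        | exact hxy.ne rfl
        | exact m ⟨hxm, hym⟩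
        | exact m ⟨hym, hxm⟩
    · have hym' := (isMono_congr (agree y hy)).1 hym
      simp only [Set.mem_insert_iff, Set.mem_singleton_iff, not_or] at hy
      obtain ⟨hyw, hyv₁, hyv₂, hyu₁, hyu₂⟩ := hy
      rcases hx with rfl | rfl | rfl | rfl | rfl
      · exact four _ hcw hxm
      · exact hok u₂ y (htrans₂ y hyu₂ hyv₁ (hkeep₁ x y hv₁u₁ hv hyu₁ hyv₂ hxy)) ⟨m₁ hxm, hym'⟩
      · exact hok u₁ y (hkeep₂ u₁ y hu hv₁u₁.symm hyu₂ hyv₁ (htrans₁ y hyu₁ hyv₂ hxy))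
          ⟨m₂ hxm, hym'⟩
      · exact four _ hc₁ hxm
      · exact four _ hc₂ hxm

/-! ### The coloring theorem -/

lemma isolate_lt {V : Type*} {G : SimpleGraph V} {D : Set V} {x y : V} (hx : x ∈ D)
    (hxy : G.Adj x y) : G.isolate D < G :=
  lt_of_le_of_ne (isolate_le G D) fun h =>
    absurd hx (show (G.isolate D).Adj x y by rw [h]; exact hxy).2.1

/-- Induction on `G`: each unavoidable configuration is reducible, and the reductions only delete
edges. -/
theorem HasWeakTreewidthLE.isPairColorable {V : Type*} [Finite V] (G : SimpleGraph V)
    (hG : G.HasWeakTreewidthLE 2) (hdeg : ∀ v, (G.neighborSet v).ncard ≤ 4) :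
    G.IsPairColorable := by
  induction G using WellFoundedLT.induction with
  | _ G ih =>
  by_cases hne : G = ⊥
  · subst hne
    exact fun M _ => ⟨_, hasColorDegrees_bot, fun x y _ ⟨⟨i, h, _⟩, _⟩ => by simp at h⟩
  have sub : ∀ (D : Set V) (x y : V), x ∈ D → y ∈ G.neighborSet x →
      (G.isolate D).IsPairColorable := fun D x y hx hxy =>
    ih _ (isolate_lt hx hxy) (hG.anti (isolate_le G D)) fun v =>
      (Set.ncard_le_ncard fun z hz => isolate_le G D hz).trans (hdeg v)
  obtain ⟨v, w, hv⟩ | ⟨v, u, w, huw, hv, hu⟩ | ⟨v₁, v₂, a, b, hv, hab, ha, hb, hv₁, hv₂⟩ |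
    ⟨w, v₁, v₂, u₁, u₂, hv, hu, hw, hcw, hc₁, hc₂, hv₁, hv₂⟩ := hG.exists_configuration hne
  · exact .of_leaf hv (hdeg w) (sub {v} v w rfl (by simp [hv]))
  · have h := sub {v} v u rfl (by simp [hv])
    have huv : G.Adj u v := adj_symm G (show u ∈ G.neighborSet v by simp [hv])
    have h0 : (G.neighborSet u).ncard ≠ 0 := Set.ncard_ne_zero_of_mem huv
    obtain h1 | h2 | h3 : (G.neighborSet u).ncard = 1 ∨ (G.neighborSet u).ncard = 2 ∨
        (G.neighborSet u).ncard = 3 := by omega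
    · obtain ⟨z, hz⟩ := Set.ncard_eq_one.1 h1
      exact .of_leaf hz (hdeg z) (sub {u} u z rfl (by simp [hz]))
    · exact .of_adj_degree_two huw hv h2 (hdeg w) h
    · exact .of_adj_degree_three huw hv h3 (hdeg w) h
  · exact .of_twins hab hv hv₁ hv₂ (le_antisymm (hdeg a) ha) (le_antisymm (hdeg b) hb)
      (sub _ v₁ a (.inl rfl) (by simp [hv₁]))
  · exact .of_triangles hv hu hw hv₁ hv₂ hcw (le_antisymm (hdeg u₁) hc₁)
      (le_antisymm (hdeg u₂) hc₂) (sub _ w v₁ (.inl rfl) (by simp [hw]))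

/-- The edge coloring given by a decomposition of `G`: the edges of `F true` get the color `0`, all
others the color `1`. -/
noncomputable def labelingOfDecomposition {V : Type*} (G : SimpleGraph V)
    (F : Bool → SimpleGraph V) : G.EdgeLabeling (Fin 2) :=
  open Classical in fun e => if e.1 ∈ (F true).edgeSet then 0 else 1

lemma labelGraph_labelingOfDecomposition {V : Type*} {G : SimpleGraph V}
    {F : Bool → SimpleGraph V} (hdisj : Disjoint (F true) (F false))
    (hG : F true ⊔ F false = G) :
    (G.labelingOfDecomposition F).labelGraph 0 = F true ∧
      (G.labelingOfDecomposition F).labelGraph 1 = F false := by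
  subst hG
  constructor <;> ext x y <;>
    simp only [EdgeLabeling.labelGraph_adj, labelingOfDecomposition, mem_edgeSet]
  · constructor
    · rintro ⟨h, h'⟩
      by_contra hn
      simp [hn] at h'
    · intro h
      exact ⟨.inl h, by simp [h]⟩
  · constructor
    · rintro ⟨h, h'⟩
      refine h.resolve_left fun hn => ?_
      simp [hn] at h'
    · intro h
      have : ¬ (F true).Adj x y := fun h' => disjoint_left.1 hdisj _ _ h' h
      exact ⟨.inr h, by simp [this]⟩

lemma isMono_of_isMonochromatic {V : Type*} [Finite V] {G : SimpleGraph V}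
    {c : G.EdgeLabeling (Fin 2)} {d : Bool → V → ℕ}
    (hd₀ : ∀ v, ((c.labelGraph 0).neighborSet v).ncard = d true v)
    (hd₁ : ∀ v, ((c.labelGraph 1).neighborSet v).ncard = d false v) {v : V}
    (h : IsMonochromatic c v) : IsMono d v := by
  obtain ⟨h2, hc⟩ := h
  have h2' : (G.neighborSet v).ncard = 2 := by simp [Set.ncard, h2]
  obtain ⟨x, y, -, e⟩ := Set.ncard_eq_two.1 h2'
  have hx : G.Adj v x := show x ∈ G.neighborSet v from e ▸ (by simp)
  have all : ∀ k, c.get v x hx = k → (c.labelGraph k).neighborSet v = G.neighborSet v := by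
    rintro k rfl
    ext z
    rw [mem_neighborSet, EdgeLabeling.labelGraph_adj]
    exact ⟨fun ⟨h, _⟩ => h, fun h => ⟨h, hc z x h hx⟩⟩
  have none : ∀ k, c.get v x hx ≠ k → (c.labelGraph k).neighborSet v = ∅ := by
    intro k hk
    ext z
    rw [mem_neighborSet, EdgeLabeling.labelGraph_adj]
    exact ⟨fun ⟨h, h'⟩ => hk ((hc x z hx h).trans h'), fun h => h.elim⟩
  by_cases h0 : c.get v x hx = 0
  · refine ⟨true, ?_, ?_⟩
    · rw [← hd₀, all 0 h0, h2']
    · rw [Bool.not_true, ← hd₁, none 1 (by simp [h0]), Set.ncard_empty]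
  · refine ⟨false, ?_, ?_⟩
    · rw [← hd₁, all 1 (by omega), h2']
    · rw [Bool.not_false, ← hd₀, none 0 h0, Set.ncard_empty]

end SimpleGraph

theorem mainTheorem7 {V : Type*} [Fintype V] (G : SimpleGraph V) [DecidableRel G.Adj]
    (hG : G.IsPartialKTree 2) (hΔ : G.maxDegree ≤ 4)
    (S : Finset (Finset V)) (hS : G.IsDisjointPairsOfDegreeTwo S) :
    ∃ c : G.EdgeLabeling (Fin 2),
      SimpleGraph.IsLinearColoring c ∧ SimpleGraph.Satisfies c S := by
  classical
  let M : SimpleGraph V :=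
    { Adj := fun x y => x ≠ y ∧ ∃ P ∈ S, x ∈ P ∧ y ∈ P
      symm := ⟨fun x y ⟨h, P, hP, hx, hy⟩ => ⟨h.symm, P, hP, hy, hx⟩⟩
      loopless := ⟨fun x h => h.1 rfl⟩ }
  have hM : M.IsPairing := by
    rintro x y z ⟨hxy, P, hP, hxP, hyP⟩ ⟨hxz, Q, hQ, hxQ, hzQ⟩
    obtain rfl : P = Q := by
      by_contra hPQ
      exact Finset.disjoint_left.1 (hS.disjoint P hP Q hQ hPQ) hxP hxQ
    by_contra hyz
    have h3 : ({x, y, z} : Finset V) ⊆ P := by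
      simp [Finset.insert_subset_iff, hxP, hyP, hzQ]
    have := Finset.card_le_card h3
    rw [hS.card_eq_two P hP, Finset.card_eq_three.2 ⟨x, y, z, hxy, hxz, hyz, rfl⟩] at this
    omega
  have hdeg : ∀ v, (G.neighborSet v).ncard ≤ 4 := fun v => by
    rw [Set.ncard_eq_toFinset_card', ← SimpleGraph.neighborFinset_def,
      SimpleGraph.card_neighborFinset_eq_degree]
    exact (G.degree_le_maxDegree v).trans hΔ
  obtain ⟨d, ⟨F, hF, hdisj, hFG, hFd⟩, hok⟩ := hG.hasWeakTreewidthLE.isPairColorable G hdeg M hM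
  obtain ⟨h0, h1⟩ := SimpleGraph.labelGraph_labelingOfDecomposition hdisj hFG
  refine ⟨G.labelingOfDecomposition F, fun i => ?_, fun P hP x hx y hy => ?_⟩
  · fin_cases i
    · exact h0.symm ▸ hF true
    · exact h1.symm ▸ hF false
  · by_contra hxy
    have hmono := fun v => SimpleGraph.isMono_of_isMonochromatic (d := d) (v := v)
      (fun v => by rw [h0, hFd]) (fun v => by rw [h1, hFd])
    exact hok x y ⟨hxy, P, hP, hx.1, hy.1⟩ ⟨hmono x hx.2, hmono y hy.2⟩
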